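/- **Setting.** Let $\|\cdot\|$ be an arbitrary norm on $\mathbb{R}^n$ and $\|\cdot\|_*$ its conjugate norm. Consider $$\Psi^*=\min_{x\in X}\Big\{\Psi(x):=\sum_{i=1}^m f_i(x)+h(x)+\mu\,\omega(x)\Big\},$$ where $X\subseteq\mathbb{R}^n$ is closed and convex, $h:X\to\mathbb{R}$ is convex, $\omega:X\to\mathbb{R}$ is strongly convex with modulus $1$ with respect to $\|\cdot\|$, $\mu>0$, and $f_i:\mathbb{R}^n\to\mathbb{R}$ are convex and differentiable with $\|\nabla f_i(x)-\nabla f_i(x')\|_*\le L_i\|x-x'\|$ for all $x,x'\in\mathbb{R}^n$, $L_i\ge 0$. Let $f=\sum_i f_i$ and let $L_f\ge 0$ satisfy $\|\nabla f(x)-\nabla f(x')\|_*\le L_f\|x-x'\|$ for all $x,x'\in\mathbb{R}^n$. Let $J_i(y)=\sup_x\{\langle x,y\rangle-f_i(x)\}$ be the conjugate of $f_i$ and $\mathcal{Y}_i$ the set where it is finite. For selected subgradients $\omega'(x^0)\in\partial\omega(x^0)$ and $J_i'(y^0)$ put $$P(x^0,x)=\omega(x)-\omega(x^0)-\langle\omega'(x^0),x-x^0\rangle,\qquad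 D_i(y^0,y)=J_i(y)-J_i(y^0)-\langle J_i'(y^0),y-y^0\rangle .$$ **The randomized primal-dual gradient (RPDG) method** with constant parameters $\tau\ge0$, $\eta>0$, $\alpha\in(0,1)$ and probabilities $p_1,\dots,p_m$. Let $x^0=x^{-1}\in X$, $y_i^0=\nabla f_i(x^0)$, $J_i'(y_i^0)=\underline{x}_i^0=x^0$, and let $\omega'(x^0)\in\partial\omega(x^0)$ be arbitrary. For $t=1,2,\dots$ draw $i_t$, independently of $i_1,\dots,i_{t-1}$, with $\mathrm{Prob}\{i_t=i\}=p_i$, and set $$\tilde x^t=\alpha(x^{t-1}-x^{t-2})+x^{t-1},$$ $$y_{i_t}^t\in\operatorname*{argmin}_{y\in\mathcal{Y}_{i_t}}\{-\langle\tilde x^t,y\rangle+J_{i_t}(y)+\tau D_{i_t}(y_{i_t}^{t-1},y)\},\qquad y_i^t=y_i^{t-1}\ (i\ne i_t),$$ $$\tilde y_{i_t}^t=p_{i_t}^{-1}(y_{i_t}^t-y_{i_t}^{t-1})+y_{i_t}^{t-1},\qquad \tilde y_i^t=y_i^{t-1}\ (i\neq i_t),$$ $$x^t\in\operatorname*{argmin}_{x\in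 X}\Big\{\Big\langle \sum_{i=1}^m\tilde y_i^t,x\Big\rangle+h(x)+\mu\,\omega(x)+\eta P(x^{t-1},x)\Big\},$$ where these subproblems are assumed to be solvable and the subgradients used in later iterations are selected as follows: $J_i'(y_i^t)=\underline{x}_i^t$ with $\underline{x}_{i_t}^t=(\tilde x^t+\tau\underline{x}_{i_t}^{t-1})/(1+\tau)$ and $\underline{x}_i^t=\underline{x}_i^{t-1}$ for $i\ne i_t$; and $\omega'(x^t)\in\partial\omega(x^t)$ is chosen, depending only on $i_1,\dots,i_t$, so that for some $h'(x^t)\in\partial h(x^t)$ $$\Big\langle \sum_{i=1}^m\tilde y_i^t+h'(x^t)+(\mu+\eta)\omega'(x^t)-\eta\,\omega'(x^{t-1}),\,x-x^t\Big\rangle\ge0\qquad\text{for all }x\in X.$$ **Theorem 3.1.** Suppose that $(1-\alpha)(1+\tau)\le p_i$ and $\eta\tau p_i\ge 4L_i$ for $i=1,\dots,m$, and $\eta\le\alpha(\mu+\eta)$. Let $x^*\in X$ be the optimal solution, so that $\Psi(x^*)=\Psi^*$. Then for every $k\ge1$ $$\mathbb{E}[P(x^k,x^*)]\le\Big(1+\frac{L_f\alpha}{(1-\alpha)\eta}\Big)\alpha^kP(x^0,x^*),$$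 $$\mathbb{E}[\Psi(\bar x^k)-\Psi^*]\le\alpha^{k/2}\Big(\alpha^{-1}\eta+\frac{3-2\alpha}{1-\alpha}L_f+\frac{2L_f^2\alpha}{(1-\alpha)\eta}\Big)P(x^0,x^*),$$ where $\bar x^k=\big(\sum_{t=1}^k\theta_t\big)^{-1}\sum_{t=1}^k\theta_tx^t$ with $\theta_t=\alpha^{-t}$, and the (finite) expectations are taken with respect to $i_1,\dots,i_k$. -/

import Mathlib

noncomputable section

namespace RPDG

/-! The role of `ℝⁿ` with an arbitrary norm `‖·‖` is played by a finite-dimensional real normed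
space `E`.  Gradients live in `StrongDual ℝ E`, whose norm is the conjugate norm, and `⟨g, x⟩` is
the value `g x`. -/

section Convex

variable {E : Type*} [NormedAddCommGroup E] [NormedSpace ℝ E]

/-- The subdifferential at `x` of a convex function `φ : X → ℝ`. -/
def subdiff (X : Set E) (φ : E → ℝ) (x : E) : Set (StrongDual ℝ E) :=
  {s | ∀ z ∈ X, φ x + s (z - x) ≤ φ z}

/-- The effective domain of the conjugate function of `φ`: the dual points at which it is finite. -/
def conjDomain (φ : E → ℝ) : Set (StrongDual ℝ E) :=
  {y | BddAbove (Set.range fun x : E => y x - φ x)}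

/-- The conjugate function `J(y) = sup_x (⟨x, y⟩ - φ(x))`, to be used on `conjDomain φ` only. -/
def conj (φ : E → ℝ) (y : StrongDual ℝ E) : ℝ :=
  ⨆ x : E, (y x - φ x)

/-- The primal prox-function `P(x₀, x) = ω(x) - [ω(x₀) + ⟨s₀, x - x₀⟩]`, where `s₀` is the selected
subgradient `ω'(x₀)`. -/
def primalBregman (ω : E → ℝ) (x₀ : E) (s₀ : StrongDual ℝ E) (x : E) : ℝ :=
  ω x - (ω x₀ + s₀ (x - x₀))

/-- The dual prox-function `D(y₀, y) = J(y) - [J(y₀) + ⟨u₀, y - y₀⟩]`, where `J` is the conjugate of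
`φ` and `u₀` is the selected subgradient `J'(y₀)`. -/
def dualBregman (φ : E → ℝ) (y₀ : StrongDual ℝ E) (u₀ : E) (y : StrongDual ℝ E) : ℝ :=
  conj φ y - (conj φ y₀ + (y - y₀) u₀)

/-- The dual prox-mapping: the set of minimizers of `⟨-xt, y⟩ + J(y) + τ D(y₀, y)` over the domain
of `J`. -/
def dualProx (φ : E → ℝ) (xt : E) (y₀ : StrongDual ℝ E) (u₀ : E) (τ : ℝ) :
    Set (StrongDual ℝ E) :=
  {y | y ∈ conjDomain φ ∧
    IsMinOn (fun v : StrongDual ℝ E => -(v xt) + conj φ v + τ * dualBregman φ y₀ u₀ v)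
      (conjDomain φ) y}

end Convex

/-- The problem `min_{x ∈ X} Ψ(x) = ∑ i, f i x + h x + μ * ω x` with its standing assumptions. -/
structure Problem (E : Type*) [NormedAddCommGroup E] [NormedSpace ℝ E] (m : ℕ) where
  X : Set E
  f : Fin m → E → ℝ
  L : Fin m → ℝ
  h : E → ℝ
  ω : E → ℝ
  μ : ℝ
  isClosed_X : IsClosed X
  convex_X : Convex ℝ X
  convexOn_f : ∀ i, ConvexOn ℝ Set.univ (f i)
  differentiable_f : ∀ i, Differentiable ℝ (f i)
  L_nonneg : ∀ i, 0 ≤ L i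
  lipschitz_f : ∀ i x₁ x₂, ‖fderiv ℝ (f i) x₁ - fderiv ℝ (f i) x₂‖ ≤ L i * ‖x₁ - x₂‖
  convexOn_h : ConvexOn ℝ X h
  strongConvexOn_ω : StrongConvexOn X 1 ω
  μ_nonneg : 0 ≤ μ

namespace Problem

variable {E : Type*} [NormedAddCommGroup E] [NormedSpace ℝ E] {m : ℕ}

/-- The smooth part `f = ∑ i, f i`. -/
def smooth (Q : Problem E m) (x : E) : ℝ := ∑ i, Q.f i x

/-- The objective function. -/
def Ψ (Q : Problem E m) (x : E) : ℝ := Q.smooth x + Q.h x + Q.μ * Q.ω x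

/-- The primal prox-mapping: the set of minimizers over `X` of
`⟨g, x⟩ + h(x) + μ ω(x) + η P(x₀, x)`, with `s₀` in the role of `ω'(x₀)`. -/
def primalProx (Q : Problem E m) (g : StrongDual ℝ E) (x₀ : E) (s₀ : StrongDual ℝ E) (η : ℝ) :
    Set E :=
  {x | x ∈ Q.X ∧
    IsMinOn (fun z => g z + Q.h z + Q.μ * Q.ω z + η * primalBregman Q.ω x₀ s₀ z) Q.X x}

/-- The subgradients of `ω` at the prox-point `x₁` that may be selected as `ω'(x₁)`: those which,
with some subgradient `h'` of `h` at `x₁`, satisfy the optimality condition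
`⟨g + h' + (μ + η) ω'(x₁) - η ω'(x₀), z - x₁⟩ ≥ 0` for all `z ∈ X` of the prox-mapping. -/
def subgradSelection (Q : Problem E m) (g : StrongDual ℝ E) (s₀ : StrongDual ℝ E) (η : ℝ)
    (x₁ : E) : Set (StrongDual ℝ E) :=
  {s | s ∈ subdiff Q.X Q.ω x₁ ∧ ∃ h' ∈ subdiff Q.X Q.h x₁,
    ∀ z ∈ Q.X, 0 ≤ (g + h' + (Q.μ + η) • s - η • s₀) (z - x₁)}

end Problem

/-- The randomized primal-dual gradient method started at `x₀`.  All quantities of iteration `t` are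
functions of the indices drawn so far, recorded as the list `[i_t, …, i_1]` with the most recent
index first; in particular they do not depend on the future.  If `l = [i_{t-1}, …, i_1]` then the
next iteration is `t = l.length + 1`, `x l` is `x^{t-1}`, `x l.tail` is `x^{t-2}` (and
`x [].tail = x [] = x₀` encodes `x^{-1} = x^0`), and `x (i :: l)` is `x^t` if `i_t = i`. -/
structure Run {E : Type*} [NormedAddCommGroup E] [NormedSpace ℝ E] {m : ℕ}
    (Q : Problem E m) (p : Fin m → ℝ) (τ η α : ℕ → ℝ) (x₀ : E) where
  /-- the primal iterates `x^t` -/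
  x : List (Fin m) → E
  /-- the selected subgradients `ω'(x^t)` -/
  s : List (Fin m) → StrongDual ℝ E
  /-- the dual iterates `y_i^t` -/
  y : List (Fin m) → Fin m → StrongDual ℝ E
  /-- the selected subgradients `J_i'(y_i^t)` of the conjugate functions -/
  u : List (Fin m) → Fin m → E
  /-- the primal predictions: `xt l` is the extrapolated point of iteration `l.length + 1` -/
  xt : List (Fin m) → E
  /-- the dual predictions: `yt i l` is formed in iteration `l.length + 1` if `i` is drawn -/
  yt : Fin m → List (Fin m) → Fin m → StrongDual ℝ E
  x₀_mem : x₀ ∈ Q.X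
  x_init : x [] = x₀
  s_init : s [] ∈ subdiff Q.X Q.ω x₀
  y_init : ∀ i, y [] i = fderiv ℝ (Q.f i) x₀
  u_init : ∀ i, u [] i = x₀
  xt_eq : ∀ l, xt l = α (l.length + 1) • (x l - x l.tail) + x l
  y_step : ∀ i l, y (i :: l) i ∈ dualProx (Q.f i) (xt l) (y l i) (u l i) (τ (l.length + 1))
  y_stay : ∀ i l j, j ≠ i → y (i :: l) j = y l j
  u_step : ∀ i l, u (i :: l) i =
    (1 + τ (l.length + 1))⁻¹ • (xt l + τ (l.length + 1) • u l i)
  u_stay : ∀ i l j, j ≠ i → u (i :: l) j = u l j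
  yt_step : ∀ i l, yt i l i = (p i)⁻¹ • (y (i :: l) i - y l i) + y l i
  yt_stay : ∀ i l j, j ≠ i → yt i l j = y l j
  x_step : ∀ i l, x (i :: l) ∈ Q.primalProx (∑ j, yt i l j) (x l) (s l) (η (l.length + 1))
  s_step : ∀ i l, s (i :: l) ∈
    Q.subgradSelection (∑ j, yt i l j) (s l) (η (l.length + 1)) (x (i :: l))

/-- The list `[i_k, …, i_1]` of the first `k` indices of a sequence; `I t` is the index drawn in
iteration `t + 1`. -/
def history {m : ℕ} (I : ℕ → Fin m) : ℕ → List (Fin m)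
  | 0 => []
  | k + 1 => I k :: history I k

namespace Run

variable {E : Type*} [NormedAddCommGroup E] [NormedSpace ℝ E] {m : ℕ}
  {Q : Problem E m} {p : Fin m → ℝ} {τ η α : ℕ → ℝ} {x₀ : E}

/-- `P(x^t, z)` for the iterate `x^t` reached after the indices in `l`. -/
def P (R : Run Q p τ η α x₀) (l : List (Fin m)) (z : E) : ℝ :=
  primalBregman Q.ω (R.x l) (R.s l) z

/-- The ergodic mean `(∑_{t=1}^k θ_t)⁻¹ ∑_{t=1}^k θ_t x^t` along the index sequence `I`. -/
def mean (R : Run Q p τ η α x₀) (θ : ℕ → ℝ) (I : ℕ → Fin m) (k : ℕ) : E :=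
  (∑ t ∈ Finset.Icc 1 k, θ t)⁻¹ • ∑ t ∈ Finset.Icc 1 k, θ t • R.x (history I t)

end Run

end RPDG

end

/-! Conjugates disappear at once: each dual iterate is the gradient of `f i` at the averaged point
`R.u l i` (`y_eq_fderiv`), so the dual prox-distance to the gradient at `z` becomes `gradBregman
(Q.f i) (R.u l i) z`. Each prox-step yields a three-point inequality. The extrapolation of `x` and
the `1 / p i` correction of `y` make these fit together up to products of one dual step with one
primal step. Young's inequality absorbs those products: the primal half is paid by strong convexity
of `ω` and a carried-over quadratic term, the dual half by co-coercivity and `4 * L i ≤ η * τ * p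
i`. Averaged over the drawn index, `lyapunov` therefore contracts by the factor `α`, with `linGap`
to spare (`sum_p_mul_lyapunov_le`).

Weighting by `α⁻ᵗ` and telescoping bounds the weighted sum of expected `linGap`s plus the last
weighted Lyapunov value. At a minimizer `linGap` is nonnegative and the Lyapunov function dominates
`η / α * P`, which gives the distance estimate. For the objective, Jensen's inequality costs an
extra `Lf * P` per iterate. Each weighted term of this kind is bounded, so they add up to a multiple
of `k`; since the weights sum to at least `k * α^(-k/2)`, the rate is `α^(k/2)`. -/

namespace RPDG

/-! ### Bregman distances of smooth functions and the dual prox-step. -/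

section Smooth

variable {E : Type*} [NormedAddCommGroup E] [NormedSpace ℝ E]

/-- The Bregman distance `φ(a) - φ(b) - ⟨∇φ(b), a - b⟩` of a differentiable function. -/
noncomputable def gradBregman (φ : E → ℝ) (a b : E) : ℝ :=
  φ a - φ b - fderiv ℝ φ b (a - b)

theorem hasDerivAt_comp_line {φ : E → ℝ} (hd : Differentiable ℝ φ) (a d : E) (t : ℝ) :
    HasDerivAt (fun t : ℝ => φ (a + t • d)) (fderiv ℝ φ (a + t • d) d) t := by
  have h1 : HasDerivAt (fun t : ℝ => a + t • d) d t := by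
    simpa using ((hasDerivAt_id t).smul_const d).const_add a
  exact (hd (a + t • d)).hasFDerivAt.comp_hasDerivAt t h1

theorem gradBregman_nonneg {φ : E → ℝ} (hc : ConvexOn ℝ Set.univ φ) (hd : Differentiable ℝ φ)
    (a b : E) : 0 ≤ gradBregman φ a b := by
  have hline : ConvexOn ℝ Set.univ (fun t : ℝ => φ (b + t • (a - b))) := by
    have := hc.comp_affineMap (AffineMap.lineMap b a : ℝ →ᵃ[ℝ] E)
    refine this.congr fun t _ => ?_
    simp [AffineMap.lineMap_apply, add_comm]
  have h := hline.le_slope_of_hasDerivAt (Set.mem_univ (0 : ℝ)) (Set.mem_univ (1 : ℝ)) one_pos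
    (hasDerivAt_comp_line hd b (a - b) 0)
  simp [slope_def_field] at h
  simp only [gradBregman, map_sub]
  linarith

/-- Along the segment from `b` to `a`, the Lipschitz bound makes the derivative of `φ` minus its
quadratic majorant nonpositive. -/
theorem gradBregman_le_of_lipschitz {φ : E → ℝ} (hd : Differentiable ℝ φ) {L : ℝ}
    (hL : ∀ x₁ x₂, ‖fderiv ℝ φ x₁ - fderiv ℝ φ x₂‖ ≤ L * ‖x₁ - x₂‖) (a b : E) :
    gradBregman φ a b ≤ L / 2 * ‖a - b‖ ^ 2 := by
  set d := a - b with hdef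
  let ψ : ℝ → ℝ := fun t => φ (b + t • d) - t * fderiv ℝ φ b d - L / 2 * ‖d‖ ^ 2 * t ^ 2
  have hψ : ∀ t, HasDerivAt ψ
      (fderiv ℝ φ (b + t • d) d - fderiv ℝ φ b d - L / 2 * ‖d‖ ^ 2 * (2 * t)) t := by
    intro t
    have h1 := hasDerivAt_comp_line hd b d t
    have h2 := (hasDerivAt_id t).mul_const (fderiv ℝ φ b d)
    have h3 := (hasDerivAt_pow 2 t).const_mul (L / 2 * ‖d‖ ^ 2)
    exact ((h1.sub h2).sub h3).congr_deriv (by simp)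
  have hanti : AntitoneOn ψ (Set.Icc 0 1) := by
    refine antitoneOn_of_deriv_nonpos (convex_Icc 0 1)
      (fun t _ => (hψ t).continuousAt.continuousWithinAt)
      (fun t _ => (hψ t).differentiableAt.differentiableWithinAt) fun t ht => ?_
    rw [interior_Icc] at ht
    rw [(hψ t).deriv]
    have h1 := (fderiv ℝ φ (b + t • d) - fderiv ℝ φ b).le_opNorm d
    have h2 := hL (b + t • d) b
    rw [add_sub_cancel_left, norm_smul, Real.norm_of_nonneg ht.1.le] at h2
    have h3 := mul_le_mul_of_nonneg_right h2 (norm_nonneg d)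
    have h4 := (Real.le_norm_self _).trans h1
    simp only [sub_apply] at h4
    nlinarith
  have h := hanti (Set.left_mem_Icc.2 zero_le_one) (Set.right_mem_Icc.2 zero_le_one) zero_le_one
  simp only [ψ, one_smul, zero_smul, add_zero] at h
  rw [show b + d = a by simp [hdef]] at h
  simp only [gradBregman, ← hdef]
  linarith

/-- Co-coercivity of the gradient of a smooth convex function. -/
theorem norm_fderiv_sub_sq_le {φ : E → ℝ} (hc : ConvexOn ℝ Set.univ φ)
    (hd : Differentiable ℝ φ) {L : ℝ} (hL₀ : 0 ≤ L)
    (hL : ∀ x₁ x₂, ‖fderiv ℝ φ x₁ - fderiv ℝ φ x₂‖ ≤ L * ‖x₁ - x₂‖) (a b : E) :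
    ‖fderiv ℝ φ a - fderiv ℝ φ b‖ ^ 2 ≤ 2 * L * gradBregman φ a b := by
  have hB := gradBregman_nonneg hc hd a b
  have hnn : 0 ≤ 2 * L * gradBregman φ a b := by positivity
  -- Compare the tangent bound from `b` with the quadratic bound from `a`, both at `a - e`. Scaling
  -- `e` then gives a nonnegative quadratic, whose discriminant bounds the dual norm; `L = 0` needs
  -- no separate case.
  have key : ∀ e : E, (fderiv ℝ φ a - fderiv ℝ φ b) e ≤
      gradBregman φ a b + L / 2 * ‖e‖ ^ 2 := by
    intro e
    have h1 := gradBregman_nonneg hc hd (a - e) b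
    have h2 := gradBregman_le_of_lipschitz hd hL (a - e) a
    simp only [gradBregman, map_sub, sub_sub_cancel_left, norm_neg, map_neg,
      sub_apply] at *
    linarith
  refine (Real.le_sqrt (norm_nonneg _) hnn).1 ?_
  refine ContinuousLinearMap.opNorm_le_bound _ (Real.sqrt_nonneg _) fun x => ?_
  have hdis : discrim (L / 2 * ‖x‖ ^ 2) (-((fderiv ℝ φ a - fderiv ℝ φ b) x))
      (gradBregman φ a b) ≤ 0 := by
    refine discrim_le_zero fun s => ?_
    have := key (s • x)
    rw [norm_smul, mul_pow, Real.norm_eq_abs, sq_abs, map_smul, smul_eq_mul] at this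
    nlinarith
  rw [discrim] at hdis
  rw [Real.norm_eq_abs]
  refine abs_le_of_sq_le_sq ?_ (by positivity)
  rw [mul_pow, Real.sq_sqrt hnn]
  nlinarith

theorem conj_fderiv {φ : E → ℝ} (hc : ConvexOn ℝ Set.univ φ) (hd : Differentiable ℝ φ) (u : E) :
    fderiv ℝ φ u ∈ conjDomain φ ∧ conj φ (fderiv ℝ φ u) = fderiv ℝ φ u u - φ u := by
  have hle : ∀ x, fderiv ℝ φ u x - φ x ≤ fderiv ℝ φ u u - φ u := by
    intro x
    have := gradBregman_nonneg hc hd x u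
    simp only [gradBregman, map_sub] at this
    linarith
  have hbdd : fderiv ℝ φ u ∈ conjDomain φ := ⟨_, by rintro _ ⟨x, rfl⟩; exact hle x⟩
  exact ⟨hbdd, le_antisymm (ciSup_le hle) (le_ciSup hbdd u)⟩

/-- The dual prox-mapping evaluates a gradient at the averaged point. -/
theorem eq_fderiv_of_mem_dualProx {φ : E → ℝ} (hc : ConvexOn ℝ Set.univ φ)
    (hd : Differentiable ℝ φ) {xt u₀ : E} {y₀ y : StrongDual ℝ E} {τ : ℝ} (hτ : 0 ≤ τ)
    (hy : y ∈ dualProx φ xt y₀ u₀ τ) :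
    y = fderiv ℝ φ ((1 + τ)⁻¹ • (xt + τ • u₀)) := by
  set u := (1 + τ)⁻¹ • (xt + τ • u₀) with hu
  have hu' : xt + τ • u₀ = (1 + τ) • u := by
    rw [hu, smul_smul, mul_inv_cancel₀ (by positivity), one_smul]
  have hv : ∀ v : StrongDual ℝ E, v xt + τ * v u₀ = (1 + τ) * v u := by
    intro v
    simpa using congrArg v hu'
  obtain ⟨hmem, hconj⟩ := conj_fderiv hc hd u
  have hmin := hy.2 hmem
  simp only [Set.mem_ofPred_eq, dualBregman, hconj, sub_apply] at hmin
  -- Up to a constant the prox objective is `(1 + τ) * (conj φ v - v u)`. Testing it against the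
  -- gradient at `u` forces Fenchel equality for `y` at `u`, so `u` maximizes `y z - φ z`.
  have h1 : (1 + τ) * (conj φ y - y u) ≤ (1 + τ) * (-φ u) := by
    linarith [hv y, hv (fderiv ℝ φ u)]
  have h2 := le_of_mul_le_mul_left h1 (by positivity)
  have hmax : IsLocalMax (fun z => y z - φ z) u := by
    refine Filter.Eventually.of_forall fun z => ?_
    have : y z - φ z ≤ conj φ y := le_ciSup hy.1 z
    linarith
  have h3 := hmax.fderiv_eq_zero
  rw [fderiv_fun_sub y.differentiableAt (hd u), ContinuousLinearMap.fderiv] at h3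
  exact sub_eq_zero.1 h3

/-- The three-point inequality of the dual prox-mapping, in terms of gradients. -/
theorem dual_three_point {φ : E → ℝ} (hc : ConvexOn ℝ Set.univ φ) (hd : Differentiable ℝ φ)
    {τ : ℝ} (hτ : 0 ≤ τ) (xt u₀ z u : E) (hu : u = (1 + τ)⁻¹ • (xt + τ • u₀)) :
    (fderiv ℝ φ z - fderiv ℝ φ u) (xt - z) ≤
      τ * gradBregman φ u₀ z - (1 + τ) * gradBregman φ u z - τ * gradBregman φ u₀ u := by
  have hu' : xt + τ • u₀ = (1 + τ) • u := by
    rw [hu, smul_smul, mul_inv_cancel₀ (by positivity), one_smul]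
  have hv : ∀ v : StrongDual ℝ E, v xt + τ * v u₀ = (1 + τ) * v u := by
    intro v
    simpa using congrArg v hu'
  have h1 := hv (fderiv ℝ φ z)
  have h2 := hv (fderiv ℝ φ u)
  -- The right side minus the left side is exactly this Bregman distance.
  have h3 := gradBregman_nonneg hc hd z u
  simp only [gradBregman, map_sub, sub_apply] at *
  linarith

/-- Combine strong convexity and the subgradient inequality at `x + t (z - x)`, divide by `t`, and
let `t` tend to zero. -/
theorem primalBregman_ge {X : Set E} {ω : E → ℝ} (hω : StrongConvexOn X 1 ω) {x z : E}
    (hx : x ∈ X) (hz : z ∈ X) {s : StrongDual ℝ E} (hs : s ∈ subdiff X ω x) :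
    1 / 2 * ‖z - x‖ ^ 2 ≤ primalBregman ω x s z := by
  have key : ∀ t : ℝ, 0 < t → t ≤ 1 →
      (1 - t) * (1 / 2 * ‖z - x‖ ^ 2) ≤ primalBregman ω x s z := by
    intro t ht ht1
    have h1 := hω.2 hx hz (sub_nonneg.2 ht1) ht.le (by ring)
    have h2 := hs _ (hω.1 hx hz (sub_nonneg.2 ht1) ht.le (by ring))
    have h3 : (1 - t) • x + t • z - x = t • (z - x) := by module
    rw [h3, map_smul] at h2
    rw [norm_sub_rev x z] at h1
    simp only [smul_eq_mul] at h1 h2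
    rw [primalBregman]
    refine le_of_mul_le_mul_left ?_ ht
    linarith
  refine le_of_forall_pos_lt_add fun ε hε => ?_
  set N := 1 / 2 * ‖z - x‖ ^ 2 with hN
  have hN0 : 0 ≤ N := by positivity
  -- This `t` satisfies `t * (N + 1) ≤ ε`, hence `t * N < ε`.
  have h := key (min 1 (ε / (N + 1))) (by positivity) (min_le_left _ _)
  have h2 : min 1 (ε / (N + 1)) * (N + 1) ≤ ε :=
    (le_div_iff₀ (by positivity)).1 (min_le_right _ _)
  have h3 : 0 < min 1 (ε / (N + 1)) := by positivity
  nlinarith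

end Smooth

/-! ### The linearized gap and the primal prox-step. -/

namespace Problem

variable {E : Type*} [NormedAddCommGroup E] [NormedSpace ℝ E] {m : ℕ} (Q : Problem E m)

theorem differentiable_smooth : Differentiable ℝ Q.smooth :=
  Differentiable.fun_sum fun i _ => Q.differentiable_f i

theorem fderiv_smooth (x : E) : fderiv ℝ Q.smooth x = ∑ i, fderiv ℝ (Q.f i) x :=
  fderiv_fun_sum fun i _ => (Q.differentiable_f i) x

theorem sum_gradBregman (a b : E) :
    ∑ i, gradBregman (Q.f i) a b = gradBregman Q.smooth a b := by
  simp only [gradBregman, fderiv_smooth, smooth, Finset.sum_sub_distrib,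
    sum_apply]

/-- The nonsmooth part of the gap between `x` and `z`, with `f` linearized at `z`. -/
noncomputable def linGap (z x : E) : ℝ :=
  Q.h x + Q.μ * Q.ω x - (Q.h z + Q.μ * Q.ω z) + fderiv ℝ Q.smooth z (x - z)

theorem convexOn_h_add_ω : ConvexOn ℝ Q.X fun x => Q.h x + Q.μ * Q.ω x :=
  Q.convexOn_h.add ((Q.strongConvexOn_ω.convexOn fun r => by simp; positivity).smul Q.μ_nonneg)

theorem convexOn_linGap (z : E) : ConvexOn ℝ Q.X (Q.linGap z) := by
  refine ⟨Q.convex_X, fun x hx y hy a b ha hb hab => ?_⟩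
  have h1 := Q.convexOn_h_add_ω.2 hx hy ha hb hab
  simp only [linGap, map_sub, map_add, map_smul, smul_eq_mul] at *
  obtain rfl : b = 1 - a := by linarith
  linarith

theorem Ψ_sub_eq (x z : E) : Q.Ψ x - Q.Ψ z = Q.linGap z x + gradBregman Q.smooth x z := by
  simp only [Ψ, linGap, gradBregman]
  ring

/-- Moving from the minimizer a fraction `t` towards `x` changes `Ψ` by at most `t * linGap` plus a
term of order `t ^ 2`; divide by `t` and let it vanish. -/
theorem linGap_nonneg {Lf : ℝ} (hLf : 0 ≤ Lf)
    (hLf_lip : ∀ x₁ x₂, ‖fderiv ℝ Q.smooth x₁ - fderiv ℝ Q.smooth x₂‖ ≤ Lf * ‖x₁ - x₂‖)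
    {z x : E} (hz : z ∈ Q.X) (hmin : IsMinOn Q.Ψ Q.X z) (hx : x ∈ Q.X) :
    0 ≤ Q.linGap z x := by
  have key : ∀ t : ℝ, 0 < t → t ≤ 1 → 0 ≤ Q.linGap z x + t * (Lf / 2 * ‖x - z‖ ^ 2) := by
    intro t ht ht1
    have hmem := Q.convex_X hz hx (sub_nonneg.2 ht1) ht.le (by ring)
    have h1 := (Q.convexOn_linGap z).2 hz hx (sub_nonneg.2 ht1) ht.le (by ring)
    have h2 : Q.Ψ z ≤ _ := hmin hmem
    have h3 := Q.Ψ_sub_eq ((1 - t) • z + t • x) z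
    have h4 := gradBregman_le_of_lipschitz Q.differentiable_smooth hLf_lip
      ((1 - t) • z + t • x) z
    have h5 : (1 - t) • z + t • x - z = t • (x - z) := by module
    rw [h5, norm_smul, Real.norm_of_nonneg ht.le] at h4
    have h6 : Q.linGap z z = 0 := by simp [linGap]
    rw [h6] at h1
    simp only [smul_eq_mul] at h1
    refine le_of_mul_le_mul_left ?_ ht
    linarith
  refine le_of_forall_pos_lt_add fun ε hε => ?_
  set N := Lf / 2 * ‖x - z‖ ^ 2 with hN
  have hN0 : 0 ≤ N := by positivity
  have h := key (min 1 (ε / (N + 1))) (by positivity) (min_le_left _ _)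
  have h2 : min 1 (ε / (N + 1)) * (N + 1) ≤ ε :=
    (le_div_iff₀ (by positivity)).1 (min_le_right _ _)
  have h3 : 0 < min 1 (ε / (N + 1)) := by positivity
  nlinarith

/-- The three-point inequality of the primal prox-mapping. -/
theorem primal_three_point {g s₀ s : StrongDual ℝ E} {η : ℝ} {x₀ x₁ z : E}
    (hs : s ∈ Q.subgradSelection g s₀ η x₁) (hz : z ∈ Q.X) :
    g (x₁ - z) + (Q.h x₁ + Q.μ * Q.ω x₁) - (Q.h z + Q.μ * Q.ω z) ≤
      η * primalBregman Q.ω x₀ s₀ z - (Q.μ + η) * primalBregman Q.ω x₁ s z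
        - η * primalBregman Q.ω x₀ s₀ x₁ := by
  obtain ⟨-, h', hh, hopt⟩ := hs
  have h1 := hh z hz
  have h2 := hopt z hz
  simp only [primalBregman, sub_apply, add_apply,
    smul_apply, smul_eq_mul, map_sub] at *
  linarith

end Problem

end RPDG

namespace RPDG

/-! ### One iteration of the method and the Lyapunov function. -/

namespace Run

variable {E : Type*} [NormedAddCommGroup E] [NormedSpace ℝ E] {m : ℕ}
  {Q : Problem E m} {p : Fin m → ℝ} {τ η α : ℝ} {x₀ : E}
  (R : Run Q p (fun _ => τ) (fun _ => η) (fun _ => α) x₀)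

theorem x_mem (l : List (Fin m)) : R.x l ∈ Q.X := by
  cases l with
  | nil => rw [R.x_init]; exact R.x₀_mem
  | cons i l => exact (R.x_step i l).1

theorem s_mem (l : List (Fin m)) : R.s l ∈ subdiff Q.X Q.ω (R.x l) := by
  cases l with
  | nil => rw [R.x_init]; exact R.s_init
  | cons i l => exact (R.s_step i l).1

theorem half_norm_sq_le_P (l : List (Fin m)) {z : E} (hz : z ∈ Q.X) :
    1 / 2 * ‖z - R.x l‖ ^ 2 ≤ R.P l z :=
  primalBregman_ge Q.strongConvexOn_ω (R.x_mem l) hz (R.s_mem l)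

theorem P_nonneg (l : List (Fin m)) {z : E} (hz : z ∈ Q.X) : 0 ≤ R.P l z :=
  (by positivity : (0 : ℝ) ≤ 1 / 2 * ‖z - R.x l‖ ^ 2).trans (R.half_norm_sq_le_P l hz)

/-- The point at which the gradient of `f i` is evaluated if `i` is drawn after the indices `l`. -/
noncomputable def uHat (l : List (Fin m)) (i : Fin m) : E :=
  (1 + τ)⁻¹ • (R.xt l + τ • R.u l i)

theorem u_cons_self (l : List (Fin m)) (i : Fin m) : R.u (i :: l) i = R.uHat l i :=
  R.u_step i l

theorem y_eq_fderiv (hτ : 0 ≤ τ) (l : List (Fin m)) (i : Fin m) :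
    R.y l i = fderiv ℝ (Q.f i) (R.u l i) := by
  induction l with
  | nil => rw [R.y_init, R.u_init]
  | cons j l ih =>
    by_cases hij : i = j
    · subst hij
      rw [R.u_cons_self]
      exact eq_fderiv_of_mem_dualProx (Q.convexOn_f i) (Q.differentiable_f i) hτ (R.y_step i l)
    · rw [R.y_stay j l i hij, R.u_stay j l i hij, ih]

/-- The change of the dual iterate if `i` is drawn after the indices `l`. -/
noncomputable def dualStep (l : List (Fin m)) (i : Fin m) : StrongDual ℝ E :=
  fderiv ℝ (Q.f i) (R.uHat l i) - fderiv ℝ (Q.f i) (R.u l i)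

theorem y_cons_sub (hτ : 0 ≤ τ) (l : List (Fin m)) (i : Fin m) :
    R.y (i :: l) i - R.y l i = R.dualStep l i := by
  rw [R.y_eq_fderiv hτ, R.y_eq_fderiv hτ, R.u_cons_self, dualStep]

theorem sum_y_cons (hτ : 0 ≤ τ) (l : List (Fin m)) (i : Fin m) :
    ∑ j, R.y (i :: l) j = ∑ j, R.y l j + R.dualStep l i := by
  rw [← R.y_cons_sub hτ, ← sub_eq_iff_eq_add', ← Finset.sum_sub_distrib]
  refine Finset.sum_eq_single i (fun j _ hj => ?_) (by simp)
  rw [R.y_stay i l j hj, sub_self]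

theorem sum_yt (hτ : 0 ≤ τ) (l : List (Fin m)) (i : Fin m) :
    ∑ j, R.yt i l j = ∑ j, R.y l j + (p i)⁻¹ • R.dualStep l i := by
  rw [← R.y_cons_sub hτ, ← sub_eq_iff_eq_add', ← Finset.sum_sub_distrib]
  refine (Finset.sum_eq_single i (fun j _ hj => ?_) (by simp)).trans ?_
  · rw [R.yt_stay i l j hj, sub_self]
  · rw [R.yt_step, add_sub_cancel_right]

/-- The Lyapunov function of the method, with respect to the reference point `z`. -/
noncomputable def lyapunov (z : E) (l : List (Fin m)) : ℝ :=
  η / α * R.P l z + ∑ i, (1 + τ) / p i * gradBregman (Q.f i) (R.u l i) z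
    + (∑ i, R.y l i - fderiv ℝ Q.smooth z) (R.x l - R.x l.tail)
    + η / 4 * ‖R.x l - R.x l.tail‖ ^ 2

theorem lyapunov_nil (z : E) : R.lyapunov z [] =
    η / α * R.P [] z + ∑ i, (1 + τ) / p i * gradBregman (Q.f i) x₀ z := by
  simp [lyapunov, R.u_init]

theorem norm_fderiv_sub_sq_le (h₃ : ∀ i, 4 * Q.L i ≤ η * τ * p i) (i : Fin m) (a b : E) :
    ‖fderiv ℝ (Q.f i) a - fderiv ℝ (Q.f i) b‖ ^ 2 ≤
      η * τ * p i / 2 * gradBregman (Q.f i) a b := by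
  have h1 := RPDG.norm_fderiv_sub_sq_le (Q.convexOn_f i) (Q.differentiable_f i) (Q.L_nonneg i)
    (Q.lipschitz_f i) a b
  have h2 := gradBregman_nonneg (Q.convexOn_f i) (Q.differentiable_f i) a b
  nlinarith [h₃ i]

/-- The bilinear term may be negative. Splitting the quadratic term with weights `p i`, which sum to
one, lets each coordinate absorb its share by Young's inequality and co-coercivity. -/
theorem le_lyapunov (hτ : 0 ≤ τ) (hη : 0 < η) (hp : ∀ i, 0 < p i) (hp1 : ∑ i, p i = 1)
    (h₃ : ∀ i, 4 * Q.L i ≤ η * τ * p i) (z : E) (l : List (Fin m)) :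
    η / α * R.P l z ≤ R.lyapunov z l := by
  set d := R.x l - R.x l.tail with hd
  have key : ∀ i, 0 ≤ (1 + τ) / p i * gradBregman (Q.f i) (R.u l i) z
      + (R.y l i - fderiv ℝ (Q.f i) z) d + p i * (η / 4 * ‖d‖ ^ 2) := by
    intro i
    have hB := gradBregman_nonneg (Q.convexOn_f i) (Q.differentiable_f i) (R.u l i) z
    set B := gradBregman (Q.f i) (R.u l i) z
    have h1 : ‖R.y l i - fderiv ℝ (Q.f i) z‖ ^ 2 ≤ η * τ * p i / 2 * B := by
      rw [R.y_eq_fderiv hτ]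
      exact norm_fderiv_sub_sq_le h₃ i _ _
    set a := ‖R.y l i - fderiv ℝ (Q.f i) z‖ with ha
    have h2 := neg_le_of_abs_le ((R.y l i - fderiv ℝ (Q.f i) z).le_opNorm d)
    rw [← ha] at h2
    have hpi := hp i
    have hple : p i ≤ 1 := hp1 ▸ Finset.single_le_sum (fun j _ => (hp j).le) (Finset.mem_univ i)
    have h3 : a ^ 2 / (η * p i) ≤ τ / 2 * B := by
      rw [div_le_iff₀ (by positivity)]
      linarith
    have h4 : τ / 2 * B ≤ (1 + τ) / p i * B := by
      refine mul_le_mul_of_nonneg_right ?_ hB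
      rw [le_div_iff₀ hpi]
      nlinarith
    have h5 : a * ‖d‖ ≤ a ^ 2 / (η * p i) + p i * (η / 4 * ‖d‖ ^ 2) := by
      have h6 : a ^ 2 / (η * p i) + p i * (η / 4 * ‖d‖ ^ 2) - a * ‖d‖ =
          (a - η * p i / 2 * ‖d‖) ^ 2 / (η * p i) := by
        field_simp
        ring
      have h7 : 0 ≤ (a - η * p i / 2 * ‖d‖) ^ 2 / (η * p i) := by positivity
      linarith
    linarith
  have hsum := Finset.sum_nonneg fun i (_ : i ∈ Finset.univ) => key i
  rw [Finset.sum_add_distrib, Finset.sum_add_distrib, ← Finset.sum_mul, hp1,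
    ← sum_apply, Finset.sum_sub_distrib, ← Q.fderiv_smooth] at hsum
  rw [lyapunov, ← hd]
  linarith

/-- The one-step inequality if `i` is drawn after the indices `l`. -/
theorem step_of_drawn (hτ : 0 ≤ τ) (hη : 0 < η) (hα₀ : 0 < α) (hα₁ : α < 1)
    (h₂ : η ≤ α * (Q.μ + η)) (h₃ : ∀ i, 4 * Q.L i ≤ η * τ * p i) {z : E} (hz : z ∈ Q.X)
    (l : List (Fin m)) (i : Fin m) (hpi : 0 < p i) (hple : p i ≤ 1) :
    Q.linGap z (R.x (i :: l)) + η / α * R.P (i :: l) z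
      + (∑ j, R.y (i :: l) j - fderiv ℝ Q.smooth z) (R.x (i :: l) - R.x l)
      + η / 4 * ‖R.x (i :: l) - R.x l‖ ^ 2 ≤
    η * R.P l z + α * (∑ j, R.y l j - fderiv ℝ Q.smooth z) (R.x l - R.x l.tail)
      + α * (η / 4 * ‖R.x l - R.x l.tail‖ ^ 2)
      - (∑ j, R.y l j - fderiv ℝ Q.smooth z) (R.xt l - z)
      - (p i)⁻¹ * R.dualStep l i (R.xt l - z)
      + τ / p i * gradBregman (Q.f i) (R.u l i) (R.uHat l i) := by
  set q := R.dualStep l i with hq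
  set B := gradBregman (Q.f i) (R.u l i) (R.uHat l i)
  set a := ‖q‖ with ha
  set b := ‖R.x (i :: l) - R.x l‖ with hb
  set c := ‖R.x l - R.x l.tail‖ with hc
  have h1 := Q.primal_three_point (x₀ := R.x l) (R.s_step i l) hz
  have h2 : 1 / 2 * b ^ 2 ≤ primalBregman Q.ω (R.x l) (R.s l) (R.x (i :: l)) :=
    R.half_norm_sq_le_P l (R.x_mem _)
  have h3 : η / α * R.P (i :: l) z ≤ (Q.μ + η) * R.P (i :: l) z := by
    refine mul_le_mul_of_nonneg_right ?_ (R.P_nonneg _ hz)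
    rw [div_le_iff₀ hα₀]
    linarith
  have h4 := mul_le_mul_of_nonneg_left h2 hη.le
  have hqB : a ^ 2 ≤ η * τ * p i / 2 * B := by
    rw [ha, hq, dualStep, norm_sub_rev]
    exact norm_fderiv_sub_sq_le h₃ i _ _
  have hb' : -(q (R.x (i :: l) - R.x l)) ≤ a * b :=
    (neg_le_abs _).trans (q.le_opNorm _)
  have hc' : q (R.x l - R.x l.tail) ≤ a * c := (le_abs_self _).trans (q.le_opNorm _)
  have hpinv : 1 ≤ (p i)⁻¹ := (one_le_inv₀ hpi).2 hple
  have h5 : ((p i)⁻¹ - 1) * -(q (R.x (i :: l) - R.x l)) ≤ ((p i)⁻¹ - 1) * (a * b) :=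
    mul_le_mul_of_nonneg_left hb' (by linarith)
  have h6 : α * (p i)⁻¹ * q (R.x l - R.x l.tail) ≤ α * (p i)⁻¹ * (a * c) :=
    mul_le_mul_of_nonneg_left hc' (by positivity)
  -- Strong convexity supplies `η / 2 * b ^ 2`: half is spent here, the other half is the quadratic
  -- term of the new Lyapunov value. The bound `h8` spends the old quadratic term.
  have h7 : ((p i)⁻¹ - 1) * (a * b) ≤ η / 4 * b ^ 2 + (p i)⁻¹ ^ 2 * a ^ 2 / η := by
    have e : η / 4 * b ^ 2 + (p i)⁻¹ ^ 2 * a ^ 2 / η - (p i)⁻¹ * (a * b) =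
        ((p i)⁻¹ * a - η / 2 * b) ^ 2 / η := by
      field_simp
      ring
    have : 0 ≤ ((p i)⁻¹ * a - η / 2 * b) ^ 2 / η := by positivity
    have : 0 ≤ a * b := by positivity
    linarith
  have h8 : α * (p i)⁻¹ * (a * c) ≤ α * (η / 4 * c ^ 2) + (p i)⁻¹ ^ 2 * a ^ 2 / η := by
    have e : η / 4 * c ^ 2 + (p i)⁻¹ ^ 2 * a ^ 2 / η - (p i)⁻¹ * (a * c) =
        ((p i)⁻¹ * a - η / 2 * c) ^ 2 / η := by
      field_simp
      ring
    have h9 : 0 ≤ ((p i)⁻¹ * a - η / 2 * c) ^ 2 / η := by positivity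
    have h10 := mul_nonneg hα₀.le (e ▸ h9)
    have h11 : α * ((p i)⁻¹ ^ 2 * a ^ 2 / η) ≤ (p i)⁻¹ ^ 2 * a ^ 2 / η :=
      mul_le_of_le_one_left (by positivity) hα₁.le
    linarith
  -- Both Young remainders together; the constant 4 in `h₃` is what makes them fit.
  have h9 : 2 * ((p i)⁻¹ ^ 2 * a ^ 2 / η) ≤ τ / p i * B := by
    have e : τ / p i * B = 2 * ((p i)⁻¹ ^ 2 * (η * τ * p i / 2 * B) / η) := by
      field_simp
    rw [e]
    gcongr
  rw [R.sum_yt hτ] at h1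
  rw [R.sum_y_cons hτ, R.xt_eq]
  simp only [Problem.linGap, P, add_apply, sub_apply, smul_apply, smul_eq_mul, map_sub, map_add,
    map_smul] at *
  linarith

/-- Only the drawn coordinate moves, and its probability cancels the weight `1 / p i`, so every
coordinate contributes its full change to the mean. -/
theorem sum_p_mul_dual (f : Fin m → E → ℝ) (hp : ∀ i, 0 < p i) (hp1 : ∑ i, p i = 1) (z : E)
    (l : List (Fin m)) :
    ∑ i, p i * ∑ j, (1 + τ) / p j * gradBregman (f j) (R.u (i :: l) j) z =
      ∑ j, ((1 + τ) / p j * gradBregman (f j) (R.u l j) z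
        + (1 + τ) * (gradBregman (f j) (R.uHat l j) z - gradBregman (f j) (R.u l j) z)) := by
  have h : ∀ i, ∑ j, (1 + τ) / p j * gradBregman (f j) (R.u (i :: l) j) z =
      ∑ j, (1 + τ) / p j * gradBregman (f j) (R.u l j) z
        + (1 + τ) / p i * (gradBregman (f i) (R.uHat l i) z - gradBregman (f i) (R.u l i) z) := by
    intro i
    rw [← sub_eq_iff_eq_add', ← Finset.sum_sub_distrib]
    refine (Finset.sum_eq_single i (fun j _ hj => ?_) (by simp)).trans ?_
    · rw [R.u_stay i l j hj, sub_self]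
    · rw [R.u_cons_self, mul_sub]
  simp only [h, mul_add, Finset.sum_add_distrib, ← Finset.sum_mul, hp1, one_mul]
  congr 1
  refine Finset.sum_congr rfl fun i _ => ?_
  have := (hp i).ne'
  field_simp

/-- The expected decrease of the Lyapunov function in one iteration. -/
theorem sum_p_mul_lyapunov_le (hτ : 0 ≤ τ) (hη : 0 < η) (hα₀ : 0 < α) (hα₁ : α < 1)
    (hp : ∀ i, 0 < p i) (hp1 : ∑ i, p i = 1) (h₁ : ∀ i, (1 - α) * (1 + τ) ≤ p i)
    (h₂ : η ≤ α * (Q.μ + η)) (h₃ : ∀ i, 4 * Q.L i ≤ η * τ * p i) {z : E} (hz : z ∈ Q.X)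
    (l : List (Fin m)) :
    ∑ i, p i * (Q.linGap z (R.x (i :: l)) + R.lyapunov z (i :: l)) ≤ α * R.lyapunov z l := by
  have hple : ∀ i, p i ≤ 1 := fun i =>
    hp1 ▸ Finset.single_le_sum (fun j _ => (hp j).le) (Finset.mem_univ i)
  have hstep := Finset.sum_le_sum fun i (_ : i ∈ Finset.univ) => mul_le_mul_of_nonneg_left
    (R.step_of_drawn hτ hη hα₀ hα₁ h₂ h₃ hz l i (hp i) (hple i)) (hp i).le
  set C := η * R.P l z + α * (∑ j, R.y l j - fderiv ℝ Q.smooth z) (R.x l - R.x l.tail)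
      + α * (η / 4 * ‖R.x l - R.x l.tail‖ ^ 2) with hC
  have hdual : ∀ i, p i * (C - (∑ j, R.y l j - fderiv ℝ Q.smooth z) (R.xt l - z)
      - (p i)⁻¹ * R.dualStep l i (R.xt l - z)
      + τ / p i * gradBregman (Q.f i) (R.u l i) (R.uHat l i)) =
      p i * (C - (∑ j, R.y l j - fderiv ℝ Q.smooth z) (R.xt l - z))
      + (τ * gradBregman (Q.f i) (R.u l i) (R.uHat l i) - R.dualStep l i (R.xt l - z)) := by
    intro i
    have := (hp i).ne'
    field_simp
    ring
  simp only [hdual, Finset.sum_add_distrib, ← Finset.sum_mul, hp1, one_mul] at hstep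
  have hS : (∑ j, R.y l j - fderiv ℝ Q.smooth z) (R.xt l - z) =
      ∑ i, (R.y l i - fderiv ℝ (Q.f i) z) (R.xt l - z) := by
    rw [← sum_apply, Finset.sum_sub_distrib, ← Q.fderiv_smooth]
  -- The linear terms combine to the gradient at `uHat` minus that at `z`, as in `dual_three_point`,
  -- whose `-τ * gradBregman` term cancels the Young remainder.
  have hprox : ∀ i, τ * gradBregman (Q.f i) (R.u l i) (R.uHat l i)
      - R.dualStep l i (R.xt l - z) - (R.y l i - fderiv ℝ (Q.f i) z) (R.xt l - z)
      + ((1 + τ) / p i * gradBregman (Q.f i) (R.u l i) z + (1 + τ) *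
        (gradBregman (Q.f i) (R.uHat l i) z - gradBregman (Q.f i) (R.u l i) z)) ≤
      α * ((1 + τ) / p i * gradBregman (Q.f i) (R.u l i) z) := by
    intro i
    have h4 := dual_three_point (Q.convexOn_f i) (Q.differentiable_f i) hτ (R.xt l) (R.u l i) z
      (R.uHat l i) rfl
    -- What remains is `((1 + τ) / p i - 1)` times the old distance; `h₁` makes this at most `α *
    -- ((1 + τ) / p i)` times it.
    have h5 : (1 - α) * ((1 + τ) / p i) * gradBregman (Q.f i) (R.u l i) z ≤
        gradBregman (Q.f i) (R.u l i) z := by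
      refine mul_le_of_le_one_left
        (gradBregman_nonneg (Q.convexOn_f i) (Q.differentiable_f i) _ _) ?_
      rw [← mul_div_assoc, div_le_one (hp i)]
      exact h₁ i
    rw [R.y_eq_fderiv hτ]
    simp only [dualStep, sub_apply] at *
    linarith
  have hprox' := Finset.sum_le_sum fun i (_ : i ∈ Finset.univ) => hprox i
  rw [Finset.sum_add_distrib, ← R.sum_p_mul_dual Q.f hp hp1, Finset.sum_sub_distrib,
    Finset.sum_sub_distrib, ← hS] at hprox'
  have hsplit : ∑ i, p i * (Q.linGap z (R.x (i :: l)) + R.lyapunov z (i :: l)) =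
      ∑ i, p i * (Q.linGap z (R.x (i :: l)) + η / α * R.P (i :: l) z
      + (∑ j, R.y (i :: l) j - fderiv ℝ Q.smooth z) (R.x (i :: l) - R.x l)
      + η / 4 * ‖R.x (i :: l) - R.x l‖ ^ 2)
      + ∑ i, p i * ∑ j, (1 + τ) / p j * gradBregman (Q.f j) (R.u (i :: l) j) z := by
    rw [← Finset.sum_add_distrib]
    refine Finset.sum_congr rfl fun i _ => ?_
    rw [lyapunov, List.tail_cons]
    ring
  have hC' : α * R.lyapunov z l = C + α * ∑ i, (1 + τ) / p i * gradBregman (Q.f i) (R.u l i) z := by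
    rw [lyapunov, hC]
    field_simp
    ring
  rw [Finset.sum_sub_distrib] at hstep
  rw [hsplit, hC', Finset.mul_sum]
  linarith

theorem lyapunov_nil_le {Lf : ℝ} (hα₀ : 0 < α) (hα₁ : α < 1) (hLf : 0 ≤ Lf)
    (hLf_lip : ∀ x₁ x₂, ‖fderiv ℝ Q.smooth x₁ - fderiv ℝ Q.smooth x₂‖ ≤ Lf * ‖x₁ - x₂‖)
    (hp : ∀ i, 0 < p i) (h₁ : ∀ i, (1 - α) * (1 + τ) ≤ p i) {z : E} (hz : z ∈ Q.X) :
    R.lyapunov z [] ≤ (η / α + Lf / (1 - α)) * R.P [] z := by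
  have hα : 0 < 1 - α := by linarith
  have h1 : ∑ i, (1 + τ) / p i * gradBregman (Q.f i) x₀ z ≤
      (1 - α)⁻¹ * gradBregman Q.smooth x₀ z := by
    rw [← Q.sum_gradBregman, Finset.mul_sum]
    refine Finset.sum_le_sum fun i _ => mul_le_mul_of_nonneg_right ?_
      (gradBregman_nonneg (Q.convexOn_f i) (Q.differentiable_f i) _ _)
    rw [div_le_iff₀ (hp i), inv_mul_eq_div, le_div_iff₀ hα]
    linarith [h₁ i]
  have h2 := gradBregman_le_of_lipschitz Q.differentiable_smooth hLf_lip x₀ z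
  have h3 := R.half_norm_sq_le_P [] hz
  rw [R.x_init, norm_sub_rev] at h3
  have h4 : gradBregman Q.smooth x₀ z ≤ Lf * R.P [] z := by nlinarith
  have h5 := mul_le_mul_of_nonneg_left h4 (inv_nonneg.2 hα.le)
  rw [R.lyapunov_nil, add_mul, div_eq_inv_mul Lf, mul_assoc (1 - α)⁻¹]
  linarith

end Run

end RPDG

namespace RPDG

/-! ### Integrability, and conditioning on the drawn indices. -/

section Expectation

open MeasureTheory ProbabilityTheory

variable {m : ℕ}

theorem history_congr {I J : ℕ → Fin m} {k : ℕ} (h : ∀ t < k, I t = J t) :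
    history I k = history J k := by
  induction k with
  | zero => rfl
  | succ k ih =>
    rw [history, history, h k k.lt_succ_self, ih fun t ht => h t (ht.trans k.lt_succ_self)]

/-- A quantity determined by the first `k` indices is a function of a finite tuple of them. -/
theorem exists_comp_tuple {Ω : Type*} {I : ℕ → Ω → Fin m} {F : (ℕ → Fin m) → ℝ} {k : ℕ}
    (hF : ∀ I J : ℕ → Fin m, (∀ t < k, I t = J t) → F I = F J) (w₀ : Ω) :
    ∃ G : (Finset.range k → Fin m) → ℝ,
      (fun w => F fun t => I t w) = G ∘ fun w (t : Finset.range k) => I t w := by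
  -- The sample point `w₀` only provides a filler index for positions from `k` on, which `F`
  -- ignores.
  refine ⟨fun v => F fun t => if h : t ∈ Finset.range k then v ⟨t, h⟩ else I 0 w₀, ?_⟩
  funext w
  refine hF _ _ fun t ht => ?_
  simp [ht]

variable {Ω : Type*} [MeasurableSpace Ω] {Pr : Measure Ω} [IsProbabilityMeasure Pr]
  {I : ℕ → Ω → Fin m}

theorem integrable_of_finite_dependence (hI_meas : ∀ t, Measurable (I t))
    {F : (ℕ → Fin m) → ℝ} {k : ℕ}
    (hF : ∀ I J : ℕ → Fin m, (∀ t < k, I t = J t) → F I = F J) :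
    Integrable (fun w => F fun t => I t w) Pr := by
  obtain ⟨w₀⟩ := nonempty_of_isProbabilityMeasure Pr
  obtain ⟨G, hG⟩ := exists_comp_tuple (I := I) hF w₀
  rw [hG]
  have hmeas : Measurable fun w (t : Finset.range k) => I t w :=
    measurable_pi_lambda _ fun t => hI_meas t
  have := Measure.isProbabilityMeasure_map (μ := Pr) hmeas.aemeasurable
  exact Integrable.comp_measurable Integrable.of_finite hmeas

theorem integrable_history (hI_meas : ∀ t, Measurable (I t)) (F : List (Fin m) → ℝ) (k : ℕ) :
    Integrable (fun w => F (history (fun t => I t w) k)) Pr :=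
  integrable_of_finite_dependence (F := fun J => F (history J k)) hI_meas
    fun _ _ h => congrArg F (history_congr h)

theorem sum_prob_eq_one {p : Fin m → ℝ} (hI_meas : ∀ t, Measurable (I t))
    (hI_law : ∀ t i, Pr.real {w | I t w = i} = p i) : ∑ i, p i = 1 := by
  simp only [← hI_law 0]
  rw [← probReal_univ (μ := Pr)]
  have h := sum_measureReal_preimage_singleton (μ := Pr) (f := I 0) Finset.univ
    (fun i _ => hI_meas 0 (measurableSet_singleton i))
  simpa [Set.preimage] using h

/-- The next index is independent of the history. -/
theorem integral_history_succ {p : Fin m → ℝ} (hI_meas : ∀ t, Measurable (I t))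
    (hI_indep : iIndepFun I Pr) (hI_law : ∀ t i, Pr.real {w | I t w = i} = p i)
    (F : List (Fin m) → ℝ) (k : ℕ) :
    ∫ w, F (history (fun t => I t w) (k + 1)) ∂Pr =
      ∫ w, ∑ i, p i * F (i :: history (fun t => I t w) k) ∂Pr := by
  classical
  obtain ⟨w₀⟩ := nonempty_of_isProbabilityMeasure Pr
  have hmeas : Measurable fun w (t : Finset.range k) => I t w :=
    measurable_pi_lambda _ fun t => hI_meas t
  -- The history uses the indices below `k` and the next draw only index `k`, so these blocks are
  -- disjoint.
  have hind := hI_indep.indepFun_finset (Finset.range k) {k} (by simp) hI_meas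
  let e : Fin m → Fin m → ℝ := fun i j => if j = i then 1 else 0
  have he : ∀ i, ∫ w, e i (I k w) ∂Pr = p i := by
    intro i
    have hset : {w | I k w = i} = I k ⁻¹' {i} := rfl
    rw [← hI_law k i, hset, ← integral_indicator_one (hI_meas k (measurableSet_singleton i))]
    refine integral_congr_ae (Filter.Eventually.of_forall fun w => ?_)
    simp [e, Set.indicator_apply]
  have hprod : ∀ i, ∫ w, e i (I k w) * F (i :: history (fun t => I t w) k) ∂Pr =
      p i * ∫ w, F (i :: history (fun t => I t w) k) ∂Pr := by
    intro i
    obtain ⟨G, hG⟩ := exists_comp_tuple (I := I) (k := k)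
      (F := fun J => F (i :: history J k))
      (fun _ _ h => congrArg (fun l => F (i :: l)) (history_congr h)) w₀
    have h1 : IndepFun (fun w => e i (I k w)) (fun w => F (i :: history (fun t => I t w) k)) Pr := by
      rw [hG]
      exact hind.symm.comp (φ := fun v : ({k} : Finset ℕ) → Fin m =>
        e i (v ⟨k, Finset.mem_singleton_self k⟩)) (ψ := G) .of_discrete .of_discrete
    rw [h1.integral_fun_mul_eq_mul_integral
      ((Measurable.of_discrete (f := e i)).comp (hI_meas k)).aestronglyMeasurable
      (integrable_history hI_meas (fun l => F (i :: l)) k).aestronglyMeasurable, he]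
  have hsplit : ∀ w, F (history (fun t => I t w) (k + 1)) =
      ∑ i, e i (I k w) * F (i :: history (fun t => I t w) k) := by
    intro w
    simp [e, history]
  simp only [hsplit]
  rw [integral_finsetSum, integral_finsetSum]
  · refine Finset.sum_congr rfl fun i _ => ?_
    rw [hprod, integral_const_mul]
  · exact fun i _ => (integrable_history hI_meas (fun l => F (i :: l)) k).const_mul _
  · intro i _
    refine integrable_of_finite_dependence (k := k + 1)
      (F := fun J => e i (J k) * F (i :: history J k)) hI_meas fun J J' h => ?_
    rw [h k k.lt_succ_self, history_congr fun t ht => h t (ht.trans k.lt_succ_self)]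

end Expectation

/-- The induction step reduces to Bernoulli's inequality. With `r = (√α)⁻¹` it converts the linear
factor `k` into the rate `α^(k/2)`. -/
theorem mul_pow_le_sum_pow {r : ℝ} (hr : 1 ≤ r) (k : ℕ) :
    k * r ^ k ≤ ∑ t ∈ Finset.Icc 1 k, (r ^ 2) ^ t := by
  induction k with
  | zero => simp
  | succ k ih =>
    rw [Finset.sum_Icc_succ_top (by omega)]
    have h1 := one_add_mul_le_pow (a := r - 1) (by linarith) (k + 1)
    rw [add_sub_cancel] at h1
    have h2 : r ^ (k + 1) ≤ r ^ (k + 2) := pow_le_pow_right₀ hr (by omega)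
    have h3 : 0 < r ^ k := by positivity
    have h4 : (k + 1) * r ≤ r ^ (k + 2) + k := by
      push_cast at h1
      linarith
    have h5 := mul_le_mul_of_nonneg_left h4 h3.le
    have h6 : (r ^ 2) ^ (k + 1) = r ^ k * r ^ (k + 2) := by ring
    rw [h6, pow_succ]
    push_cast
    linarith

namespace Run

variable {E : Type*} [NormedAddCommGroup E] [NormedSpace ℝ E] {m : ℕ}
  {Q : Problem E m} {p : Fin m → ℝ} {τ η α : ℝ} {x₀ : E}
  (R : Run Q p (fun _ => τ) (fun _ => η) (fun _ => α) x₀)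

/-- The optimality gap of the ergodic mean is bounded by the mean of the gaps with linearized
smooth part and of the prox-functions. -/
theorem Ψ_mean_sub_le {Lf : ℝ} (hLf : 0 ≤ Lf)
    (hLf_lip : ∀ x₁ x₂, ‖fderiv ℝ Q.smooth x₁ - fderiv ℝ Q.smooth x₂‖ ≤ Lf * ‖x₁ - x₂‖)
    {z : E} (hz : z ∈ Q.X) {θ : ℕ → ℝ} (hθ : ∀ t, 0 < θ t) (J : ℕ → Fin m) {k : ℕ} (hk : 1 ≤ k) :
    Q.Ψ (R.mean θ J k) - Q.Ψ z ≤ (∑ t ∈ Finset.Icc 1 k, θ t)⁻¹ *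
      ∑ t ∈ Finset.Icc 1 k,
        θ t * (Q.linGap z (R.x (history J t)) + Lf * R.P (history J t) z) := by
  have hW : 0 < ∑ t ∈ Finset.Icc 1 k, θ t :=
    Finset.sum_pos (fun t _ => hθ t) ⟨1, Finset.mem_Icc.2 ⟨le_rfl, hk⟩⟩
  -- The smooth part is replaced by its quadratic majorant, which is convex and, at each iterate, at
  -- most `Lf * P`.
  have hconv : ConvexOn ℝ Q.X fun x => Q.linGap z x + Lf / 2 * dist x z ^ 2 :=
    (Q.convexOn_linGap z).add
      (((convexOn_dist z Q.convex_X).pow (fun _ _ => dist_nonneg) 2).smul (by positivity))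
  have hJ := hconv.map_centerMass_le (t := Finset.Icc 1 k) (w := θ)
    (p := fun t => R.x (history J t)) (fun t _ => (hθ t).le) hW (fun t _ => R.x_mem _)
  have h1 := gradBregman_le_of_lipschitz Q.differentiable_smooth hLf_lip (R.mean θ J k) z
  rw [Q.Ψ_sub_eq]
  change Q.linGap z (R.mean θ J k) + Lf / 2 * dist (R.mean θ J k) z ^ 2 ≤
    (∑ t ∈ Finset.Icc 1 k, θ t)⁻¹ * ∑ t ∈ Finset.Icc 1 k,
      θ t * (Q.linGap z (R.x (history J t)) + Lf / 2 * dist (R.x (history J t)) z ^ 2) at hJ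
  rw [dist_eq_norm] at hJ
  refine (add_le_add_right h1 _).trans (hJ.trans ?_)
  refine mul_le_mul_of_nonneg_left (Finset.sum_le_sum fun t _ =>
    mul_le_mul_of_nonneg_left ?_ (hθ t).le) (inv_nonneg.2 hW.le)
  have h2 := mul_le_mul_of_nonneg_left (R.half_norm_sq_le_P (history J t) hz) hLf
  rw [dist_eq_norm, norm_sub_rev]
  linarith

end Run

end RPDG

/-! ### Telescoping and the final constants. -/

open MeasureTheory in
theorem theorem3p1 {E : Type*} [NormedAddCommGroup E] [NormedSpace ℝ E] [FiniteDimensional ℝ E]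
    {m : ℕ} (Q : RPDG.Problem E m) (hμ : 0 < Q.μ)
    (Lf : ℝ) (hLf : 0 ≤ Lf)
    (hLf_lip : ∀ x₁ x₂ : E,
      ‖fderiv ℝ Q.smooth x₁ - fderiv ℝ Q.smooth x₂‖ ≤ Lf * ‖x₁ - x₂‖)
    (xstar : E) (hxstar_mem : xstar ∈ Q.X) (hxstar : IsMinOn Q.Ψ Q.X xstar)
    (p : Fin m → ℝ) (τ η α : ℝ) (hτ : 0 ≤ τ) (hη : 0 < η) (hα₀ : 0 < α) (hα₁ : α < 1)
    (h₁ : ∀ i, (1 - α) * (1 + τ) ≤ p i)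
    (h₂ : η ≤ α * (Q.μ + η))
    (h₃ : ∀ i, 4 * Q.L i ≤ η * τ * p i)
    {Ω : Type*} [MeasurableSpace Ω] (Pr : MeasureTheory.Measure Ω)
    [MeasureTheory.IsProbabilityMeasure Pr]
    (I : ℕ → Ω → Fin m) (hI_meas : ∀ t, Measurable (I t))
    (hI_indep : ProbabilityTheory.iIndepFun I Pr)
    (hI_law : ∀ t i, Pr.real {w | I t w = i} = p i)
    (x₀ : E) (R : RPDG.Run Q p (fun _ => τ) (fun _ => η) (fun _ => α) x₀)
    (k : ℕ) (hk : 1 ≤ k) :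
    (MeasureTheory.Integrable
        (fun w => R.P (RPDG.history (fun t => I t w) k) xstar) Pr ∧
      ∫ w, R.P (RPDG.history (fun t => I t w) k) xstar ∂Pr ≤
        (1 + Lf * α / ((1 - α) * η)) * α ^ k * R.P [] xstar) ∧
    (MeasureTheory.Integrable
        (fun w => Q.Ψ (R.mean (fun t => (α ^ t)⁻¹) (fun t => I t w) k) - Q.Ψ xstar) Pr ∧
      ∫ w, (Q.Ψ (R.mean (fun t => (α ^ t)⁻¹) (fun t => I t w) k) - Q.Ψ xstar) ∂Pr ≤
        α ^ ((k : ℝ) / 2) *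
          (α⁻¹ * η + (3 - 2 * α) / (1 - α) * Lf + 2 * Lf ^ 2 * α / ((1 - α) * η)) *
          R.P [] xstar) := by
  have hα : 0 < 1 - α := by linarith
  have hp : ∀ i, 0 < p i := fun i => (by positivity : 0 < (1 - α) * (1 + τ)).trans_le (h₁ i)
  have hp1 := RPDG.sum_prob_eq_one hI_meas hI_law
  have hint := fun F k => RPDG.integrable_history (Pr := Pr) hI_meas F k
  have hP0 := R.P_nonneg [] hxstar_mem
  set V : ℕ → ℝ := fun t => ∫ w, R.lyapunov xstar (RPDG.history (fun t => I t w) t) ∂Pr with hV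
  set G : ℕ → ℝ := fun t => ∫ w, Q.linGap xstar (R.x (RPDG.history (fun t => I t w) t)) ∂Pr
    with hG
  set D : ℕ → ℝ := fun t => ∫ w, R.P (RPDG.history (fun t => I t w) t) xstar ∂Pr with hD
  set K := (η / α + Lf / (1 - α)) * R.P [] xstar with hK
  have hG0 : ∀ t, 0 ≤ G t := fun t => integral_nonneg fun w =>
    Q.linGap_nonneg hLf hLf_lip hxstar_mem hxstar (R.x_mem _)
  have hDV : ∀ t, η / α * D t ≤ V t := by
    intro t
    rw [hD, hV, ← integral_const_mul]
    exact integral_mono ((hint (fun l => R.P l xstar) t).const_mul _) (hint _ t) fun w =>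
      R.le_lyapunov hτ hη hp hp1 h₃ xstar _
  have hD0 : ∀ t, 0 ≤ D t := fun t => integral_nonneg fun w => R.P_nonneg _ hxstar_mem
  have hstep : ∀ t, G (t + 1) + V (t + 1) ≤ α * V t := by
    intro t
    rw [hG, hV]
    rw [← integral_add (hint (fun l => Q.linGap xstar (R.x l)) _) (hint _ _),
      RPDG.integral_history_succ hI_meas hI_indep hI_law
        (fun l => Q.linGap xstar (R.x l) + R.lyapunov xstar l), ← integral_const_mul]
    exact integral_mono
      (hint (fun l => ∑ i, p i * (Q.linGap xstar (R.x (i :: l)) + R.lyapunov xstar (i :: l))) t)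
      ((hint _ t).const_mul _)
      fun w => R.sum_p_mul_lyapunov_le hτ hη hα₀ hα₁ hp hp1 h₁ h₂ h₃ hxstar_mem _
  -- The weights `α⁻ᵗ` turn the contraction into a telescoping sum.
  have hsum : ∀ t, ∑ j ∈ Finset.Icc 1 t, (α ^ j)⁻¹ * G j + (α ^ t)⁻¹ * V t ≤ K := by
    intro t
    induction t with
    | zero =>
      have : V 0 = R.lyapunov xstar [] := by simp [hV, RPDG.history]
      simpa [this] using R.lyapunov_nil_le hα₀ hα₁ hLf hLf_lip hp h₁ hxstar_mem
    | succ t ih =>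
      rw [Finset.sum_Icc_succ_top (by omega)]
      have h := mul_le_mul_of_nonneg_left (hstep t)
        (by positivity : 0 ≤ (α ^ (t + 1))⁻¹)
      have e : (α ^ (t + 1))⁻¹ * (α * V t) = (α ^ t)⁻¹ * V t := by
        field_simp
        ring
      linarith
  have hθG : ∀ t, 0 ≤ ∑ j ∈ Finset.Icc 1 t, (α ^ j)⁻¹ * G j := fun t =>
    Finset.sum_nonneg fun j _ => mul_nonneg (by positivity) (hG0 j)
  set C := 1 + Lf * α / ((1 - α) * η) with hC
  have hCK : K = η / α * (C * R.P [] xstar) := by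
    rw [hK, hC]
    field_simp
  have hDC : ∀ t, (α ^ t)⁻¹ * D t ≤ C * R.P [] xstar := by
    intro t
    refine le_of_mul_le_mul_left ?_ (by positivity : 0 < η / α)
    rw [← hCK]
    have h := mul_le_mul_of_nonneg_left (hDV t) (by positivity : 0 ≤ (α ^ t)⁻¹)
    linarith [hsum t, hθG t]
  have hmean_int : Integrable
      (fun w => Q.Ψ (R.mean (fun t => (α ^ t)⁻¹) (fun t => I t w) k) - Q.Ψ xstar) Pr := by
    refine RPDG.integrable_of_finite_dependence (k := k) hI_meas
      (F := fun J => Q.Ψ (R.mean (fun t => (α ^ t)⁻¹) J k) - Q.Ψ xstar) fun J J' h => ?_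
    have : R.mean (fun t => (α ^ t)⁻¹) J k = R.mean (fun t => (α ^ t)⁻¹) J' k := by
      simp only [RPDG.Run.mean]
      congr 1
      refine Finset.sum_congr rfl fun t ht => ?_
      rw [RPDG.history_congr fun j hj => h j (hj.trans_le (Finset.mem_Icc.1 ht).2)]
    rw [this]
  refine ⟨⟨hint (fun l => R.P l xstar) k, ?_⟩, hmean_int, ?_⟩
  · have h := hDC k
    rw [inv_mul_le_iff₀ (by positivity)] at h
    linarith
  · set W := ∑ t ∈ Finset.Icc 1 k, (α ^ t)⁻¹ with hW
    have hθ : ∀ t, 0 < (α ^ t)⁻¹ := fun t => by positivity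
    have hfin : ∀ t, Integrable (fun w => (α ^ t)⁻¹ *
        (Q.linGap xstar (R.x (RPDG.history (fun t => I t w) t))
          + Lf * R.P (RPDG.history (fun t => I t w) t) xstar)) Pr := fun t =>
      hint (fun l => (α ^ t)⁻¹ * (Q.linGap xstar (R.x l) + Lf * R.P l xstar)) t
    have hmean : ∫ w, (Q.Ψ (R.mean (fun t => (α ^ t)⁻¹) (fun t => I t w) k) - Q.Ψ xstar) ∂Pr ≤
        W⁻¹ * ∑ t ∈ Finset.Icc 1 k, (α ^ t)⁻¹ * (G t + Lf * D t) := by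
      refine (integral_mono hmean_int
        ((integrable_finsetSum _ fun t _ => hfin t).const_mul _)
        fun w => R.Ψ_mean_sub_le hLf hLf_lip hxstar_mem hθ (fun t => I t w) hk).trans_eq ?_
      rw [integral_const_mul, integral_finsetSum _ fun t _ => hfin t]
      congr 1
      refine Finset.sum_congr rfl fun t _ => ?_
      rw [integral_const_mul, integral_add (hint (fun l => Q.linGap xstar (R.x l)) t)
        ((hint (fun l => R.P l xstar) t).const_mul _), integral_const_mul]
    have hbound : ∑ t ∈ Finset.Icc 1 k, (α ^ t)⁻¹ * (G t + Lf * D t) ≤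
        K + k * (Lf * (C * R.P [] xstar)) := by
      have h1 : ∑ t ∈ Finset.Icc 1 k, (α ^ t)⁻¹ * (Lf * D t) ≤
          ∑ t ∈ Finset.Icc 1 k, Lf * (C * R.P [] xstar) := by
        refine Finset.sum_le_sum fun t _ => ?_
        rw [mul_left_comm]
        exact mul_le_mul_of_nonneg_left (hDC t) hLf
      rw [Finset.sum_const, Nat.card_Icc, add_tsub_cancel_right, nsmul_eq_mul] at h1
      have h2 : 0 ≤ (α ^ k)⁻¹ * V k :=
        mul_nonneg (hθ k).le ((mul_nonneg (by positivity) (hD0 k)).trans (hDV k))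
      simp only [mul_add, Finset.sum_add_distrib]
      linarith [hsum k]
    have hCP : 0 ≤ C * R.P [] xstar := by positivity
    have hK0 : 0 ≤ K := by positivity
    set s := α ^ ((k : ℝ) / 2) with hs
    have hs0 : 0 < s := Real.rpow_pos_of_pos hα₀ _
    have hs1 : s ≤ 1 := Real.rpow_le_one hα₀.le hα₁.le (by positivity)
    have hsk : s = √α ^ k := by
      rw [hs, Real.sqrt_eq_rpow, ← Real.rpow_mul_natCast hα₀.le]
      congr 1
      ring
    have hr1 : 1 ≤ (√α)⁻¹ :=
      (one_le_inv₀ (Real.sqrt_pos.2 hα₀)).2 (Real.sqrt_le_one.2 hα₁.le)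
    have hWk : k * s⁻¹ ≤ W := by
      have h := RPDG.mul_pow_le_sum_pow hr1 k
      simpa only [inv_pow, Real.sq_sqrt hα₀.le, ← hsk] using h
    -- The last weight alone equals `s⁻¹ ^ 2`, and `s ≤ 1`.
    have hW1 : s⁻¹ ≤ W := by
      have h1 : (α ^ k)⁻¹ ≤ W := Finset.single_le_sum (f := fun t => (α ^ t)⁻¹)
        (fun t _ => (hθ t).le) (Finset.mem_Icc.2 ⟨hk, le_rfl⟩)
      have h2 : α ^ k = s * s := by
        rw [hsk, ← mul_pow, Real.mul_self_sqrt hα₀.le]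
      refine le_trans ?_ h1
      rw [h2]
      exact inv_anti₀ (by positivity) (mul_le_of_le_one_left hs0.le hs1)
    have hWpos : 0 < W := (inv_pos.2 hs0).trans_le hW1
    have hWs : W⁻¹ ≤ s := inv_le_of_inv_le₀ hs0 hW1
    have hWks : W⁻¹ * k ≤ s := by
      rw [inv_mul_le_iff₀ hWpos]
      exact (mul_inv_le_iff₀ hs0).1 hWk
    calc _ ≤ W⁻¹ * (K + k * (Lf * (C * R.P [] xstar))) :=
          hmean.trans (mul_le_mul_of_nonneg_left hbound (by positivity))
      _ = W⁻¹ * K + W⁻¹ * k * (Lf * (C * R.P [] xstar)) := by ring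
      _ ≤ s * K + s * (Lf * (C * R.P [] xstar)) := by gcongr
      -- Since `(3 - 2α) / (1 - α) = 2 + 1 / (1 - α)`, the claimed constant exceeds the one obtained
      -- by exactly `Lf * C`.
      _ = s * (α⁻¹ * η + (3 - 2 * α) / (1 - α) * Lf + 2 * Lf ^ 2 * α / ((1 - α) * η))
            * R.P [] xstar - s * (Lf * (C * R.P [] xstar)) := by
        rw [hK, hC]
        field_simp
        ring
      _ ≤ _ := sub_le_self _ (by positivity)
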